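/- \textbf{Language.} Fix variables $X_1,\dots,X_n$ holding nonnegative integers. Commands are $\texttt{skip}$, assignments $X_l:=0$, $X_l:=X_r$, $X_l:=X_r*X_s$, $X_l:=X_r+X_s$ with $r\neq s$, sequences $C_1;C_2$, $\texttt{choose }C_1\texttt{ or }C_2$, and $\texttt{loop }X_\ell\,\{C\}$, where $X_\ell$ is not assigned in $C$. The semantics is a relation $\vec x[\![C]\!]\vec y$ on $\mathbb N^n$: an assignment stores the exact value of its expression (alternatively: any nonnegative integer bounded by that value; the theorem holds for either convention), $\texttt{skip}$ is the identity, $;$ is relational composition, $\texttt{choose}$ is union, and $\vec x[\![\texttt{loop }X_\ell\{C\}]\!]\vec y$ iff $\vec x[\![C]\!]^k\vec y$ for some $k\le x_\ell$. \textbf{Dependences.} Types are $1<1^+<2<3$, with maximum $\sqcup$; $\alpha\simeq 1$ means $\alpha\in\{1,1^+\}$. A dependence is unary, $i\xrightarrow{\delta}j$, or binary, $(i,i')\rightrightarrows(j,j')$. The partial composition is: $(i\xrightarrow{\alpha}j)\cdot(j\xrightarrow{\beta}k)=i\xrightarrow{\alpha\sqcup\beta}k$; $(i\xrightarrow{\alpha}j)\cdot((j,j)\rightrightarrows(k,k'))=(i,i)\rightrightarrows(k,k')$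 and $((i,i')\rightrightarrows(j,j))\cdot(j\xrightarrow{\alpha}k)=(i,i')\rightrightarrows(k,k)$, both for $\alpha\simeq1$; $((i,i')\rightrightarrows(j,j'))\cdot((j,j')\rightrightarrows(k,k'))$ is $(i,i')\rightrightarrows(k,k')$ if $i\ne i'$ or $k\ne k'$, and $i\xrightarrow{2}k$ if $i=i'$ and $k=k'$. Products of several dependences associate to the left. The partial loop correction is $LC_\ell(i\xrightarrow{1^+}i)=LC_\ell(i\xrightarrow{2}i)=\ell\xrightarrow{3}i$. \textbf{Proof system.} Judgements $C,P\vdash_{lin}D,Q$, with $P,Q$ sets of variable indices (contexts: variables holding zero) and $D$ a dependence, are generated by the following rules. \begin{itemize} \item $\texttt{skip}$: $i\xrightarrow{1}i$ for $i\notin P$, with $Q=P$. \item Every assignment to $X_l$: $i\xrightarrow{1}i$ for $i\notin P$, $i\neq l$. Here $Q\setminus\{l\}=P\setminus\{l\}$, and $l\in Q$ exactly in these cases: always for $X_l:=0$; if $r\in P$ for $X_l:=X_r$; if $r\in P$ or $s\in P$ for $X_l:=X_r*X_s$; if $r,s\in P$ for $X_l:=X_r+X_s$. \item With the same $Q$: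 for $X_l:=X_r$, $r\xrightarrow{1}l$ if $r\notin P$; for $X_l:=X_r*X_s$, $t\xrightarrow{3}l$ for $t\in\{r,s\}$ if $r,s\notin P$; for $X_l:=X_r+X_s$ ($r\neq s$), $r\xrightarrow{1}l$ if $r\notin P$, $s\in P$; $s\xrightarrow{1}l$ if $r\in P$, $s\notin P$; and $t\xrightarrow{1^+}l$ for $t\in\{r,s\}$ if $r,s\notin P$. \item Binary rule, for $C$ being $\texttt{skip}$ or an assignment: if $C,P\vdash_{lin}i\xrightarrow{\alpha}j,Q$ and $C,P\vdash_{lin}i'\xrightarrow{\beta}j',Q$ with $\alpha,\beta\simeq1$, $i,i'\notin P$, $j,j'\notin Q$, and $i\ne i'$ or $j\ne j'$, then $C,P\vdash_{lin}(i,i')\rightrightarrows(j,j'),Q$. \item Choice: any judgement $C_1,P\vdash_{lin}D,Q$ or $C_2,P\vdash_{lin}D,Q$ gives $\texttt{choose }C_1\texttt{ or }C_2,P\vdash_{lin}D,Q$. \item Sequence: $C_1,P\vdash_{lin}D_1,Q$ and $C_2,Q\vdash_{lin}D_2,R$ give $C_1;C_2,P\vdash_{lin}D_1\cdot D_2,R$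 when $D_1\cdot D_2$ is defined. \item Loops, with $L=\texttt{loop }X_\ell\{C\}$ and all products required to be defined: (L0) $\texttt{skip},P\vdash_{lin}D,P$ gives $L,P\vdash_{lin}D,P$. (L1) If $\ell\notin P_0$, $m\ge1$ and $C,P_{k-1}\vdash_{lin}D_k,P_k$ for $1\le k\le m$, then $L,P_0\vdash_{lin}D_1\cdots D_m,P_m$. (L2) If $\ell\notin P_0$, $L,P_0\vdash_{lin}D_1,P_1$, $L,P_1\vdash_{lin}D_2,P_1$ and $L,P_1\vdash_{lin}D_3,P_3$, then $L,P_0\vdash_{lin}D_1\cdot LC_\ell(D_2)\cdot D_3,P_3$. \end{itemize} \textbf{Theorem.} Let $C$ be a command and $j$ a variable index. If $C,\emptyset\vdash_{lin}i\xrightarrow{3}j,Q$ is derivable for some $i$ and $Q$, then the values $y_j$ with $\vec x[\![C]\!]\vec y$ are not linearly bounded in $\vec x$. If no such judgement is derivable, then they are: there are $a_1,\dots,a_n,b\in\mathbb N$ such that $y_j\le\sum_i a_ix_i+b$ whenever $\vec x[\![C]\!]\vec y$. -/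

import Mathlib

namespace LoopLang

/-! ## Syntax of the core language over the variables `X_0, …, X_{n-1}` -/

/-- Expressions `X`, `X + Y`, `X * Y`, `0`. -/
inductive Expr (n : ℕ) : Type
  | var (r : Fin n) : Expr n
  | add (r s : Fin n) : Expr n
  | mul (r s : Fin n) : Expr n
  | zero : Expr n

/-- Commands. -/
inductive Cmd (n : ℕ) : Type
  | skip : Cmd n
  | assign (l : Fin n) (e : Expr n) : Cmd n
  | seq (C₁ C₂ : Cmd n) : Cmd n
  | loop (l : Fin n) (C : Cmd n) : Cmd n
  | choose (C₁ C₂ : Cmd n) : Cmd n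

/-- The two operands of a sum are distinct variables. -/
def Expr.WellFormed {n : ℕ} : Expr n → Prop
  | .add r s => r ≠ s
  | _ => True

/-- `C.Assigns k`: the variable `k` is on the left-hand side of some assignment in `C`. -/
def Cmd.Assigns {n : ℕ} : Cmd n → Fin n → Prop
  | .skip, _ => False
  | .assign l _, k => k = l
  | .seq C₁ C₂, k => C₁.Assigns k ∨ C₂.Assigns k
  | .loop _ C, k => C.Assigns k
  | .choose C₁ C₂, k => C₁.Assigns k ∨ C₂.Assigns k

/-- The syntactic restrictions: a loop body does not assign the loop variable, and the operands
of each addition are distinct. -/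
def Cmd.WellFormed {n : ℕ} : Cmd n → Prop
  | .skip => True
  | .assign _ e => e.WellFormed
  | .seq C₁ C₂ => C₁.WellFormed ∧ C₂.WellFormed
  | .loop l C => ¬ C.Assigns l ∧ C.WellFormed
  | .choose C₁ C₂ => C₁.WellFormed ∧ C₂.WellFormed

/-! ## Semantics -/

/-- A store holds a nonnegative integer in each variable. -/
abbrev Store (n : ℕ) : Type := Fin n → ℕ

/-- The value of an expression. -/
def Expr.eval {n : ℕ} (x : Store n) : Expr n → ℕ
  | .var r => x r
  | .add r s => x r + x s
  | .mul r s => x r * x s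
  | .zero => 0

/-- The two admissible readings of an assignment: the precise value of the expression is
assigned, or any nonnegative integer bounded by it. -/
inductive AssignMode : Type
  | exact : AssignMode
  | bounded : AssignMode

/-- `m.Admits v w`: the number `v` may be assigned when the expression has value `w`. -/
def AssignMode.Admits : AssignMode → ℕ → ℕ → Prop
  | .exact, v, w => v = w
  | .bounded, v, w => v ≤ w

/-- The `k`-fold composition of a relation with itself. -/
def relPow {α : Type*} (R : α → α → Prop) : ℕ → α → α → Prop
  | 0, x, y => x = y
  | k + 1, x, y => ∃ z, relPow R k x z ∧ R z y

/-- `C.Sem m x y`: the command `C`, started in the store `x`, can end in the store `y`. -/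
def Cmd.Sem {n : ℕ} (m : AssignMode) : Cmd n → Store n → Store n → Prop
  | .skip => fun x y => x = y
  | .assign l e => fun x y => ∃ v, m.Admits v (e.eval x) ∧ y = Function.update x l v
  | .seq C₁ C₂ => fun x y => ∃ z, C₁.Sem m x z ∧ C₂.Sem m z y
  | .loop l C => fun x y => ∃ k ≤ x l, relPow (C.Sem m) k x y
  | .choose C₁ C₂ => fun x y => C₁.Sem m x y ∨ C₂.Sem m x y

/-- The final value of the variable `j` is bounded by a linear function of the inputs. -/
def LinearlyBounded {n : ℕ} (m : AssignMode) (C : Cmd n) (j : Fin n) : Prop :=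
  ∃ (a : Fin n → ℕ) (b : ℕ), ∀ x y : Store n, C.Sem m x y → y j ≤ ∑ i, a i * x i + b

/-! ## Dependences -/

/-- The dependence types `1 < 1⁺ < 2 < 3`. -/
inductive DepType : Type
  | one : DepType
  | onePlus : DepType
  | two : DepType
  | three : DepType

/-- The position of a dependence type in the order. -/
def DepType.rank : DepType → ℕ
  | .one => 0
  | .onePlus => 1
  | .two => 2
  | .three => 3

/-- The maximum of two dependence types in the order `1 < 1⁺ < 2 < 3`. -/
def DepType.sup (α β : DepType) : DepType := if α.rank ≤ β.rank then β else α

/-- `α ≃ 1`, that is, `α` is `1` or `1⁺`. -/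
def DepType.SimOne (α : DepType) : Prop := α = .one ∨ α = .onePlus

/-- Dependences: `unary i δ j` from `i` to `j` of type `δ`; `binary i i' j j'` from `i` to `j`
and from `i'` to `j'` simultaneously. -/
inductive Dep (n : ℕ) : Type
  | unary (i : Fin n) (δ : DepType) (j : Fin n) : Dep n
  | binary (i i' j j' : Fin n) : Dep n

open Classical in
/-- The partial composition `D₁ · D₂` of dependences; `none` where it is undefined. -/
noncomputable def Dep.comp {n : ℕ} : Dep n → Dep n → Option (Dep n)
  | .unary i α j, .unary j₁ β k =>
      if j = j₁ then some (.unary i (α.sup β) k) else none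
  | .unary i α j, .binary j₁ j₂ k k' =>
      if j = j₁ ∧ j = j₂ ∧ α.SimOne then some (.binary i i k k') else none
  | .binary i i' j j', .unary j₁ α k =>
      if j = j₁ ∧ j' = j₁ ∧ α.SimOne then some (.binary i i' k k) else none
  | .binary i i' j j', .binary j₁ j₂ k k' =>
      if j = j₁ ∧ j' = j₂ then
        if i ≠ i' ∨ k ≠ k' then some (.binary i i' k k') else some (.unary i .two k)
      else none

/-- The product `D 0 · D 1 · … · D k`, associated to the left; `none` where it is undefined. -/
noncomputable def Dep.prod {n : ℕ} (D : ℕ → Dep n) : ℕ → Option (Dep n)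
  | 0 => some (D 0)
  | k + 1 => (Dep.prod D k).bind fun E => E.comp (D (k + 1))

open Classical in
/-- The loop correction operator for linear bounds, with loop variable `l`: it sends the
dependences of `i` on itself of types `1⁺` and `2` to the dependence of `i` on `l` of type `3`,
and it is undefined elsewhere. -/
noncomputable def Dep.loopCorrection {n : ℕ} (l : Fin n) : Dep n → Option (Dep n)
  | .unary i .onePlus j => if i = j then some (.unary l .three i) else none
  | .unary i .two j => if i = j then some (.unary l .three i) else none
  | _ => none

/-! ## The proof system for linear bounds -/

/-- A context is a set of variables (those that hold zero). -/
abbrev Context (n : ℕ) : Type := Set (Fin n)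

/-- The unary rules for `skip` and for assignments. -/
inductive AtomUnary {n : ℕ} :
    Cmd n → Context n → Fin n → DepType → Fin n → Context n → Prop
  | skip (P : Context n) (i : Fin n) (hi : i ∉ P) :
      AtomUnary .skip P i .one i P
  | zero (P : Context n) (l i : Fin n) (hi : i ∉ P) (hil : i ≠ l) :
      AtomUnary (.assign l .zero) P i .one i (P ∪ {l})
  | var_keep (P : Context n) (l r i : Fin n) (hi : i ∉ P) (hil : i ≠ l) :
      AtomUnary (.assign l (.var r)) P i .one i ((P \ {l}) ∪ {k | k = l ∧ r ∈ P})
  | var_copy (P : Context n) (l r : Fin n) (hr : r ∉ P) :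
      AtomUnary (.assign l (.var r)) P r .one l ((P \ {l}) ∪ {k | k = l ∧ r ∈ P})
  | mul_keep (P : Context n) (l r s i : Fin n) (hi : i ∉ P) (hil : i ≠ l) :
      AtomUnary (.assign l (.mul r s)) P i .one i
        ((P \ {l}) ∪ {k | k = l ∧ (r ∈ P ∨ s ∈ P)})
  | mul (P : Context n) (l r s t : Fin n) (hr : r ∉ P) (hs : s ∉ P) (ht : t = r ∨ t = s) :
      AtomUnary (.assign l (.mul r s)) P t .three l
        ((P \ {l}) ∪ {k | k = l ∧ (r ∈ P ∨ s ∈ P)})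
  | add_keep (P : Context n) (l r s i : Fin n) (hrs : r ≠ s) (hi : i ∉ P) (hil : i ≠ l) :
      AtomUnary (.assign l (.add r s)) P i .one i
        ((P \ {l}) ∪ {k | k = l ∧ (r ∈ P ∧ s ∈ P)})
  | add_left (P : Context n) (l r s : Fin n) (hrs : r ≠ s) (hr : r ∉ P) (hs : s ∈ P) :
      AtomUnary (.assign l (.add r s)) P r .one l
        ((P \ {l}) ∪ {k | k = l ∧ (r ∈ P ∧ s ∈ P)})
  | add_right (P : Context n) (l r s : Fin n) (hrs : r ≠ s) (hr : r ∈ P) (hs : s ∉ P) :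
      AtomUnary (.assign l (.add r s)) P s .one l
        ((P \ {l}) ∪ {k | k = l ∧ (r ∈ P ∧ s ∈ P)})
  | add_both (P : Context n) (l r s t : Fin n) (hrs : r ≠ s) (hr : r ∉ P) (hs : s ∉ P)
      (ht : t = r ∨ t = s) :
      AtomUnary (.assign l (.add r s)) P t .onePlus l
        ((P \ {l}) ∪ {k | k = l ∧ (r ∈ P ∧ s ∈ P)})

/-- `Derives C P D Q`: the judgement `C, P ⊢_lin D, Q` is derivable. -/
inductive Derives {n : ℕ} : Cmd n → Context n → Dep n → Context n → Prop
  /-- Unary rules for `skip` and assignments. -/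
  | unary {C : Cmd n} {P Q : Context n} {i j : Fin n} {δ : DepType}
      (h : AtomUnary C P i δ j Q) :
      Derives C P (.unary i δ j) Q
  /-- Binary rule for `skip` and assignments. -/
  | binary {C : Cmd n} {P Q : Context n} {i i' j j' : Fin n} {δ δ' : DepType}
      (hi : i ∉ P) (hi' : i' ∉ P) (hj : j ∉ Q) (hj' : j' ∉ Q) (hne : i ≠ i' ∨ j ≠ j')
      (h : AtomUnary C P i δ j Q) (h' : AtomUnary C P i' δ' j' Q)
      (hδ : δ.SimOne) (hδ' : δ'.SimOne) :
      Derives C P (.binary i i' j j') Q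
  | choose_left {C₁ C₂ : Cmd n} {P Q : Context n} {D : Dep n}
      (h : Derives C₁ P D Q) : Derives (.choose C₁ C₂) P D Q
  | choose_right {C₁ C₂ : Cmd n} {P Q : Context n} {D : Dep n}
      (h : Derives C₂ P D Q) : Derives (.choose C₁ C₂) P D Q
  | seq {C₁ C₂ : Cmd n} {P Q R : Context n} {D₁ D₂ D : Dep n}
      (h₁ : Derives C₁ P D₁ Q) (h₂ : Derives C₂ Q D₂ R) (hD : D₁.comp D₂ = some D) :
      Derives (.seq C₁ C₂) P D R
  /-- The loop body is not executed. -/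
  | loop_zero {l : Fin n} {C : Cmd n} {P : Context n} {D : Dep n}
      (h : Derives .skip P D P) : Derives (.loop l C) P D P
  /-- The loop body is executed `m + 1` times. -/
  | loop_iterate {l : Fin n} {C : Cmd n} (m : ℕ) (P : ℕ → Context n) (D : ℕ → Dep n)
      {E : Dep n} (hl : l ∉ P 0)
      (h : ∀ k, k ≤ m → Derives C (P k) (D k) (P (k + 1)))
      (hE : Dep.prod D m = some E) :
      Derives (.loop l C) (P 0) E (P (m + 1))
  /-- Loop correction applied to `D₂`; the conclusion is `(D₁ · LC D₂) · D₃`. -/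
  | loop_correct {l : Fin n} {C : Cmd n} {P₀ P₁ P₃ : Context n} {D₁ D₂ D₃ L F E : Dep n}
      (hl : l ∉ P₀)
      (h₁ : Derives (.loop l C) P₀ D₁ P₁)
      (h₂ : Derives (.loop l C) P₁ D₂ P₁)
      (h₃ : Derives (.loop l C) P₁ D₃ P₃)
      (hL : D₂.loopCorrection l = some L) (hF : D₁.comp L = some F) (hE : F.comp D₃ = some E) :
      Derives (.loop l C) P₀ E P₃

end LoopLang

namespace LoopLang

variable {n : ℕ}

/-! ## Iterated relations and monotonicity of the semantics -/

/-! Lower bounds. A derivable dependence is a promise about some run from every store that vanishes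
exactly on `P` and is at least `N` elsewhere: types 1⁺ and 2 gain `N` over the source, and type 3
reaches order `N²`. Promises compose (`Dep.Realized.comp`). A dependence of type 1⁺ or 2 of a
variable on itself, in an unchanged context, costs a fixed number of iterations, so a budget of
about `N` iterations repeats it often enough to accumulate a constant multiple of `N²`
(`BudgetRealizes.correct`). Such values defeat every linear bound.

Upper bounds. By `exists_controlled`, an output without a type 3 dependence on a nonzero input is at
most one source of type 1 or a constant times the sum of its sources of type 1⁺. Unary dependences
suffice here, and only chains of type 1⁺ need correcting. The crux is that a loop must not let the
coefficient grow with the number of iterations. A link of type 1 leaves it unchanged. A link of type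
1⁺ that leaves a (context, variable) pair lying on a 1⁺ cycle produces a type 3 dependence by loop
correction; any other such link strictly raises `chainRank`, which is bounded by the finite number
of pairs. Exact runs from positive stores are enough, by monotonicity. -/

theorem relPow_add {α : Type*} {R : α → α → Prop} {a b : ℕ} {x z y : α}
    (h₁ : relPow R a x z) (h₂ : relPow R b z y) : relPow R (a + b) x y := by
  induction b generalizing y with
  | zero => cases h₂; exact h₁
  | succ b ih =>
    obtain ⟨w, hw, hR⟩ := h₂
    exact ⟨w, ih hw, hR⟩

theorem relPow_one {α : Type*} {R : α → α → Prop} {x y : α} (h : R x y) : relPow R 1 x y :=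
  ⟨x, rfl, h⟩

theorem Expr.eval_mono {x x' : Store n} (h : x ≤ x') (e : Expr n) : e.eval x ≤ e.eval x' := by
  cases e with
  | var r => exact h r
  | add r s => exact Nat.add_le_add (h r) (h s)
  | mul r s => exact Nat.mul_le_mul (h r) (h s)
  | zero => exact le_rfl

/-- Exact execution from a larger store dominates execution in either mode. -/
theorem Cmd.Sem.exists_exact_ge {m : AssignMode} {C : Cmd n} {x x' y : Store n}
    (h : C.Sem m x y) (hx : x ≤ x') : ∃ y', C.Sem .exact x' y' ∧ y ≤ y' := by
  induction C generalizing x x' y with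
  | skip => cases h; exact ⟨x', rfl, hx⟩
  | assign l e =>
    obtain ⟨v, hv, rfl⟩ := h
    refine ⟨_, ⟨e.eval x', rfl, rfl⟩, ?_⟩
    have hve : v ≤ e.eval x := by
      cases m with
      | exact => exact le_of_eq hv
      | bounded => exact hv
    intro k
    by_cases hk : k = l
    · subst hk
      simpa using hve.trans (e.eval_mono hx)
    · simpa [Function.update_of_ne hk] using hx k
  | seq C₁ C₂ ih₁ ih₂ =>
    obtain ⟨z, h₁, h₂⟩ := h
    obtain ⟨z', hz, hzz⟩ := ih₁ h₁ hx
    obtain ⟨y', hy, hyy⟩ := ih₂ h₂ hzz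
    exact ⟨y', ⟨z', hz, hy⟩, hyy⟩
  | loop l C ih =>
    obtain ⟨k, hk, h⟩ := h
    have key : ∀ k y, relPow (C.Sem m) k x y →
        ∃ y', relPow (C.Sem .exact) k x' y' ∧ y ≤ y' := by
      intro k
      induction k with
      | zero => rintro y rfl; exact ⟨x', rfl, hx⟩
      | succ k ihk =>
        rintro y ⟨z, hz, hy⟩
        obtain ⟨z', hz', hzz⟩ := ihk z hz
        obtain ⟨y', hy', hyy⟩ := ih hy hzz
        exact ⟨y', ⟨z', hz', hy'⟩, hyy⟩
    obtain ⟨y', hy', hyy⟩ := key k y h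
    exact ⟨y', ⟨k, hk.trans (hx l), hy'⟩, hyy⟩
  | choose C₁ C₂ ih₁ ih₂ =>
    rcases h with h | h
    · obtain ⟨y', hy, hyy⟩ := ih₁ h hx
      exact ⟨y', Or.inl hy, hyy⟩
    · obtain ⟨y', hy, hyy⟩ := ih₂ h hx
      exact ⟨y', Or.inr hy, hyy⟩

theorem Cmd.Sem.of_exact {m : AssignMode} {C : Cmd n} {x y : Store n}
    (h : C.Sem .exact x y) : C.Sem m x y := by
  induction C generalizing x y with
  | skip => exact h
  | assign l e =>
    obtain ⟨v, hv, rfl⟩ := h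
    refine ⟨v, ?_, rfl⟩
    cases m with
    | exact => exact hv
    | bounded => exact le_of_eq hv
  | seq C₁ C₂ ih₁ ih₂ =>
    obtain ⟨z, h₁, h₂⟩ := h
    exact ⟨z, ih₁ h₁, ih₂ h₂⟩
  | loop l C ih =>
    obtain ⟨k, hk, h⟩ := h
    refine ⟨k, hk, ?_⟩
    clear hk
    induction k generalizing y with
    | zero => exact h
    | succ k ihk =>
      obtain ⟨z, hz, hy⟩ := h
      exact ⟨z, ihk hz, ih hy⟩
  | choose C₁ C₂ ih₁ ih₂ => exact h.imp ih₁ ih₂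

/-! ## Lower bounds: derivable dependences are realized -/

/-- The store `x` is zero exactly on `P` and at least `N` elsewhere (for `N` positive). -/
def Large (P : Context n) (N : ℕ) (x : Store n) : Prop :=
  ∀ k, (k ∈ P → x k = 0) ∧ (k ∉ P → N ≤ x k)

/-- The lower bounds on the final store `y` that a dependence promises, at scale `N`. -/
def Dep.Realized (N q : ℕ) (x y : Store n) : Dep n → Prop
  | .unary i .one j => N ≤ x i ∧ x i ≤ y j
  | .unary i .onePlus j => N ≤ x i ∧ x i + N ≤ y j
  | .unary i .two j => N ≤ x i ∧ x i + N ≤ y j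
  | .unary _ .three j => N * N ≤ q * y j
  | .binary i i' j j' => (i ≠ i' ∨ j ≠ j') ∧ N ≤ x i ∧ N ≤ x i' ∧ x i ≤ y j ∧ x i' ≤ y j' ∧
      (j = j' → x i + x i' ≤ y j)

theorem Dep.Realized.mono {N N' q q' : ℕ} {x y : Store n} {D : Dep n}
    (h : D.Realized N q x y) (hN : N' ≤ N) (hq : q ≤ q') : D.Realized N' q' x y := by
  rcases D with ⟨i, δ, j⟩ | ⟨i, i', j, j'⟩
  · cases δ <;> simp only [Dep.Realized] at h ⊢
    · exact ⟨by omega, by omega⟩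
    · exact ⟨by omega, by omega⟩
    · exact ⟨by omega, by omega⟩
    · exact (Nat.mul_le_mul hN hN).trans (h.trans (Nat.mul_le_mul_right _ hq))
  · simp only [Dep.Realized] at h ⊢
    obtain ⟨h₀, h₁, h₂, h₃⟩ := h
    exact ⟨h₀, by omega, by omega, h₃⟩

theorem Dep.Realized.le {N q : ℕ} {x y : Store n} {i j : Fin n} {δ : DepType}
    (h : (Dep.unary i δ j).Realized N q x y) (hδ : δ ≠ .three) : x i ≤ y j := by
  cases δ <;> simp only [Dep.Realized] at h
  · exact h.2
  · omega
  · omega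
  · exact absurd rfl hδ

/-- Gains add up along a composition, and type 3 absorbs everything because the other types never
decrease the value. Binary dependences record two flows of the same run, so that their values may be
added when the flows meet. -/
theorem Dep.Realized.comp {N q : ℕ} {x z y : Store n} {D₁ D₂ D : Dep n}
    (h₁ : D₁.Realized N q x z) (h₂ : D₂.Realized N q z y) (hD : D₁.comp D₂ = some D) :
    D.Realized N q x y := by
  rcases D₁ with ⟨i, α, j⟩ | ⟨i, i', j, j'⟩ <;> rcases D₂ with ⟨j₁, β, k⟩ | ⟨j₁, j₂, k, k'⟩ <;>
    simp only [Dep.comp] at hD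
  · split_ifs at hD with hj
    subst hj
    cases hD
    by_cases hβ : β = .three
    · subst hβ
      have : α.sup .three = .three := by cases α <;> rfl
      rw [this]
      exact h₂
    · by_cases hα : α = .three
      · subst hα
        have hle := h₂.le hβ
        have : DepType.sup .three β = .three := by cases β <;> rfl
        rw [this]
        simp only [Dep.Realized] at h₁ ⊢
        exact h₁.trans (Nat.mul_le_mul_left _ hle)
      · cases α <;> cases β <;>
          first
          | exact absurd rfl hβ
          | exact absurd rfl hα
          | (simp only [Dep.Realized, DepType.sup, DepType.rank] at h₁ h₂ ⊢
             norm_num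
             omega)
  · split_ifs at hD with hj
    obtain ⟨rfl, rfl, hα⟩ := hj
    cases hD
    have hx : N ≤ x i ∧ x i ≤ z j := by
      rcases hα with rfl | rfl <;> simp only [Dep.Realized] at h₁ <;> exact ⟨h₁.1, by omega⟩
    simp only [Dep.Realized] at h₂ ⊢
    obtain ⟨h₀, -, -, h₃, h₄, -⟩ := h₂
    have hk : k ≠ k' := by simpa using h₀
    exact ⟨Or.inr hk, hx.1, hx.1, by omega, by omega, fun h => absurd h hk⟩
  · split_ifs at hD with hj
    obtain ⟨rfl, rfl, hα⟩ := hj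
    cases hD
    have hz : z j' ≤ y k := h₂.le (by rcases hα with rfl | rfl <;> simp)
    simp only [Dep.Realized] at h₁ ⊢
    obtain ⟨h₀, h₁, h₂, h₃, h₄, h₅⟩ := h₁
    have h₅ := h₅ trivial
    exact ⟨by simpa using h₀, h₁, h₂, by omega, by omega, fun _ => by omega⟩
  · split_ifs at hD with hj hk
    · obtain ⟨rfl, rfl⟩ := hj
      cases hD
      simp only [Dep.Realized] at h₁ h₂ ⊢
      obtain ⟨a₀, a₁, a₂, a₃, a₄, a₅⟩ := h₁
      obtain ⟨b₀, b₁, b₂, b₃, b₄, b₅⟩ := h₂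
      refine ⟨hk, a₁, a₂, by omega, by omega, fun h => ?_⟩
      have := b₅ h
      omega
    -- Two copies of `x i` meet in `k`: the result is at least `2 * x i`, hence at least `x i + N`.
    · obtain ⟨rfl, rfl⟩ := hj
      cases hD
      push Not at hk
      obtain ⟨rfl, rfl⟩ := hk
      simp only [Dep.Realized] at h₁ h₂ ⊢
      obtain ⟨a₀, a₁, a₂, a₃, a₄, a₅⟩ := h₁
      obtain ⟨b₀, b₁, b₂, b₃, b₄, b₅⟩ := h₂
      have := b₅ trivial
      exact ⟨a₁, by omega⟩

/-- Runs of the relation `R` realize the dependence `D` between the contexts `P` and `Q`. -/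
def Realizes (R : Store n → Store n → Prop) (P : Context n) (D : Dep n) (Q : Context n) : Prop :=
  ∃ K q, ∀ N ≥ K, ∀ x, Large P N x → ∃ y, R x y ∧ Large Q N y ∧ D.Realized N q x y

theorem Realizes.mono {R S : Store n → Store n → Prop} {P Q : Context n} {D : Dep n}
    (h : Realizes R P D Q) (hRS : ∀ x y, R x y → S x y) : Realizes S P D Q := by
  obtain ⟨K, q, h⟩ := h
  refine ⟨K, q, fun N hN x hx => ?_⟩
  obtain ⟨y, hy, h⟩ := h N hN x hx
  exact ⟨y, hRS _ _ hy, h⟩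

theorem Realizes.comp {R S T : Store n → Store n → Prop} {P Q W : Context n} {D₁ D₂ D : Dep n}
    (h₁ : Realizes R P D₁ Q) (h₂ : Realizes S Q D₂ W) (hD : D₁.comp D₂ = some D)
    (hT : ∀ x z y, R x z → S z y → T x y) : Realizes T P D W := by
  obtain ⟨K₁, q₁, h₁⟩ := h₁
  obtain ⟨K₂, q₂, h₂⟩ := h₂
  refine ⟨max K₁ K₂, max q₁ q₂, fun N hN x hx => ?_⟩
  obtain ⟨z, hz, hzQ, hzD⟩ := h₁ N (le_trans (le_max_left _ _) hN) x hx
  obtain ⟨y, hy, hyW, hyD⟩ := h₂ N (le_trans (le_max_right _ _) hN) z hzQ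
  exact ⟨y, hT _ _ _ hz hy, hyW,
    (hzD.mono le_rfl (le_max_left _ _)).comp (hyD.mono le_rfl (le_max_right _ _)) hD⟩

theorem Realizes.prod {R : Store n → Store n → Prop} {P : ℕ → Context n} {D : ℕ → Dep n}
    {m : ℕ} {E : Dep n} (h : ∀ k, k ≤ m → Realizes R (P k) (D k) (P (k + 1)))
    (hE : Dep.prod D m = some E) : Realizes (relPow R (m + 1)) (P 0) E (P (m + 1)) := by
  induction m generalizing E with
  | zero =>
    cases hE
    exact (h 0 le_rfl).mono fun x y hxy => relPow_one hxy
  | succ m ih =>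
    simp only [Dep.prod, Option.bind_eq_some_iff] at hE
    obtain ⟨F, hF, hE⟩ := hE
    exact (ih (fun k hk => h k (by omega)) hF).comp (h (m + 1) le_rfl) hE
      fun x z y h₁ h₂ => ⟨z, h₁, h₂⟩

/-! ### Lower bounds for `skip` and assignments -/

theorem Large.update {P : Context n} {N : ℕ} {x : Store n} (hx : Large P N x) {l : Fin n} {v : ℕ}
    {c : Prop} (h₀ : c → v = 0) (h₁ : ¬ c → N ≤ v) :
    Large ((P \ {l}) ∪ {k | k = l ∧ c}) N (Function.update x l v) := by
  intro k
  by_cases hk : k = l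
  · subst hk
    simpa using ⟨h₀, h₁⟩
  · simpa [hk, Function.update_of_ne hk] using hx k

/-- The exact effect of `skip` or an assignment. -/
def Cmd.run (x : Store n) : Cmd n → Store n
  | .assign l e => Function.update x l (e.eval x)
  | _ => x

theorem AtomUnary.realized {C : Cmd n} {P Q : Context n} {i j : Fin n} {δ : DepType}
    (h : AtomUnary C P i δ j Q) {N : ℕ} (hN : 0 < N) {x : Store n} (hx : Large P N x) :
    C.Sem .exact x (C.run x) ∧ Large Q N (C.run x) ∧ (Dep.unary i δ j).Realized N 1 x (C.run x) := by
  have hpos : ∀ k, k ∉ P → N ≤ x k := fun k hk => (hx k).2 hk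
  have hzero : ∀ k, k ∈ P → x k = 0 := fun k hk => (hx k).1 hk
  induction h with
  | skip P i hi => exact ⟨rfl, hx, hpos i hi, le_rfl⟩
  | zero P l i hi hil =>
    refine ⟨⟨0, rfl, rfl⟩, ?_, hpos i hi, ?_⟩
    · have := hx.update (l := l) (v := 0) (c := True) (fun _ => rfl) (by simp)
      have e : P ∪ {l} = (P \ {l}) ∪ {k | k = l ∧ True} := by
        ext k; by_cases hk : k = l <;> simp [hk]
      rw [e]
      exact this
    · simp [Cmd.run, Function.update_of_ne hil]
  | var_keep P l r i hi hil =>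
    exact ⟨⟨_, rfl, rfl⟩, hx.update (hzero r) (hpos r), hpos i hi,
      by simp [Cmd.run, Function.update_of_ne hil]⟩
  | var_copy P l r hr =>
    exact ⟨⟨_, rfl, rfl⟩, hx.update (hzero r) (hpos r), hpos r hr, by simp [Cmd.run, Expr.eval]⟩
  | mul_keep P l r s i hi hil =>
    refine ⟨⟨_, rfl, rfl⟩, hx.update ?_ ?_, hpos i hi,
      by simp [Cmd.run, Function.update_of_ne hil]⟩
    · rintro (h | h) <;> simp [Expr.eval, hzero _ h]
    · intro h
      push Not at h
      have := Nat.mul_le_mul (hpos r h.1) (hpos s h.2)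
      simp only [Expr.eval]
      nlinarith
  | mul P l r s t hr hs ht =>
    have := Nat.mul_le_mul (hpos r hr) (hpos s hs)
    refine ⟨⟨_, rfl, rfl⟩, hx.update ?_ ?_, ?_⟩
    · rintro (h | h) <;> simp [Expr.eval, hzero _ h]
    · intro _
      simp only [Expr.eval]
      nlinarith
    · simpa [Dep.Realized, Cmd.run, Expr.eval] using this
  | add_keep P l r s i hrs hi hil =>
    refine ⟨⟨_, rfl, rfl⟩, hx.update ?_ ?_, hpos i hi,
      by simp [Cmd.run, Function.update_of_ne hil]⟩
    · rintro ⟨h, h'⟩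
      simp [Expr.eval, hzero _ h, hzero _ h']
    · intro h
      simp only [Expr.eval]
      by_cases hr : r ∈ P
      · have := hpos s fun hs => h ⟨hr, hs⟩
        omega
      · have := hpos r hr
        omega
  | add_left P l r s hrs hr hs =>
    have hr' := hpos r hr
    refine ⟨⟨_, rfl, rfl⟩, hx.update (fun h => absurd h.1 hr) ?_, hr', ?_⟩
    · intro _
      simp only [Expr.eval]
      omega
    · simp [Cmd.run, Expr.eval]
  | add_right P l r s hrs hr hs =>
    have hs' := hpos s hs
    refine ⟨⟨_, rfl, rfl⟩, hx.update (fun h => absurd h.2 hs) ?_, hs', ?_⟩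
    · intro _
      simp only [Expr.eval]
      omega
    · simp [Cmd.run, Expr.eval]
  | add_both P l r s t hrs hr hs ht =>
    have hr' := hpos r hr
    have hs' := hpos s hs
    refine ⟨⟨_, rfl, rfl⟩, hx.update (fun h => absurd h.1 hr) ?_, ?_, ?_⟩
    · intro _
      simp only [Expr.eval]
      omega
    · rcases ht with rfl | rfl <;> assumption
    · simp only [Cmd.run, Expr.eval, Function.update_self]
      rcases ht with rfl | rfl <;> omega

/-- Two distinct simple flows of an atomic command into one variable are summed there. -/
theorem AtomUnary.add_le {C : Cmd n} {P Q Q' : Context n} {i i' j : Fin n} {δ δ' : DepType}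
    (h : AtomUnary C P i δ j Q) (h' : AtomUnary C P i' δ' j Q') (hδ : δ.SimOne)
    (hδ' : δ'.SimOne) (hne : i ≠ i') (x : Store n) : x i + x i' ≤ C.run x j := by
  cases h <;> cases h' <;> first
    | exact absurd rfl hne
    | (exfalso; simp_all; done)
    | (simp only [Cmd.run, Expr.eval, Function.update_self]
       simp_all [DepType.SimOne]
       done)
    | (rename_i ht _ _ _ ht'
       simp only [Cmd.run, Expr.eval, Function.update_self]
       rcases ht with rfl | rfl <;> rcases ht' with rfl | rfl <;>
         first
         | exact absurd rfl hne
         | omega)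

theorem Derives.realizes_atom {C : Cmd n} {P Q : Context n} {D : Dep n}
    (hC : C = .skip ∨ ∃ l e, C = .assign l e) (h : Derives C P D Q) :
    Realizes (fun x y => C.Sem .exact x y ∧ y = C.run x) P D Q := by
  refine ⟨1, 1, fun N hN x hx => ⟨C.run x, ?_⟩⟩
  cases h with
  | unary h =>
    obtain ⟨h₁, h₂, h₃⟩ := h.realized hN hx
    exact ⟨⟨h₁, rfl⟩, h₂, h₃⟩
  | @binary _ _ _ i i' j j' δ δ' hi hi' hj hj' hne h h' hδ hδ' =>
    obtain ⟨h₁, h₂, h₃⟩ := h.realized hN hx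
    obtain ⟨-, -, h₃'⟩ := h'.realized hN hx
    refine ⟨⟨h₁, rfl⟩, h₂, hne, (hx _).2 hi, (hx _).2 hi', h₃.le ?_, h₃'.le ?_, ?_⟩
    · rcases hδ with rfl | rfl <;> simp
    · rcases hδ' with rfl | rfl <;> simp
    · rintro rfl
      exact h.add_le h' hδ hδ' (by simpa using hne) x
  | _ => simp at hC

/-- As `Realizes` for runs of at most `B` iterations, with the bounds at scale `B ≤ N`. -/
def BudgetRealizes (R : Store n → Store n → Prop) (P : Context n) (D : Dep n)
    (Q : Context n) : Prop :=
  ∃ K q, ∀ B ≥ K, ∀ N ≥ B, ∀ x, Large P N x →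
    ∃ y, (∃ k ≤ B, relPow R k x y) ∧ Large Q N y ∧ D.Realized B q x y

/-! ### Lower bounds for loops: sharing a budget of iterations -/

theorem Realizes.budget {R : Store n → Store n → Prop} {P Q : Context n} {D : Dep n} {k : ℕ}
    (h : Realizes (relPow R k) P D Q) : BudgetRealizes R P D Q := by
  obtain ⟨K, q, h⟩ := h
  refine ⟨max K k, q, fun B hB N hN x hx => ?_⟩
  obtain ⟨y, hy, hyQ, hyD⟩ := h N ((le_max_left _ _).trans (hB.trans hN)) x hx
  exact ⟨y, ⟨k, (le_max_right _ _).trans hB, hy⟩, hyQ, hyD.mono hN le_rfl⟩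

theorem Dep.eq_of_loopCorrection {l : Fin n} {D L : Dep n} (h : D.loopCorrection l = some L) :
    ∃ i δ, D = .unary i δ i ∧ (δ = .onePlus ∨ δ = .two) ∧ L = .unary l .three i := by
  rcases D with ⟨i, δ, j⟩ | _
  · cases δ <;> simp only [Dep.loopCorrection] at h
    · cases h
    · split_ifs at h with hij
      subst hij
      cases h
      exact ⟨_, _, rfl, Or.inl rfl, rfl⟩
    · split_ifs at h with hij
      subst hij
      cases h
      exact ⟨_, _, rfl, Or.inr rfl, rfl⟩
    · cases h
  · cases h

theorem Dep.comp_unary_three_left {i j : Fin n} {D E : Dep n}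
    (h : (Dep.unary i .three j).comp D = some E) :
    ∃ δ k, D = .unary j δ k ∧ E = .unary i .three k := by
  rcases D with ⟨j₁, δ, k⟩ | _ <;> simp only [Dep.comp] at h
  · split_ifs at h with hj
    subst hj
    cases h
    exact ⟨δ, k, rfl, by cases δ <;> rfl⟩
  · simp [DepType.SimOne] at h

theorem Dep.comp_unary_three_right {i j : Fin n} {D E : Dep n}
    (h : D.comp (Dep.unary i .three j) = some E) : ∃ k, E = .unary k .three j := by
  rcases D with ⟨j₁, δ, k⟩ | _ <;> simp only [Dep.comp] at h
  · split_ifs at h with hj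
    cases h
    exact ⟨j₁, by cases δ <;> rfl⟩
  · simp [DepType.SimOne] at h

theorem iterate_gain {R : Store n → Store n → Prop} {P : Context n} {i : Fin n} {N K : ℕ}
    (h : ∀ x, Large P N x → ∃ y, relPow R K x y ∧ Large P N y ∧ x i + N ≤ y i) (t : ℕ)
    {x : Store n} (hx : Large P N x) : ∃ y, relPow R (t * K) x y ∧ Large P N y ∧ t * N ≤ y i := by
  induction t with
  | zero => exact ⟨x, by simp [relPow], hx, by simp⟩
  | succ t ih =>
    obtain ⟨z, hz, hzP, hzN⟩ := ih
    obtain ⟨y, hy, hyP, hyN⟩ := h z hzP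
    refine ⟨y, ?_, hyP, ?_⟩
    · rw [Nat.succ_mul]
      exact relPow_add hz hy
    · rw [Nat.succ_mul]
      omega

/-- The budget is split in three: one third to reach `P₁`, one to repeat the cycle at `i`, one for
the final dependence, which may itself come from a correction. Each pass through the cycle gains
`N`, whatever the share of the budget. -/
theorem BudgetRealizes.correct {R : Store n → Store n → Prop} {P₀ P₁ P₃ : Context n}
    {D₁ : Dep n} {i j k : Fin n} {α β : DepType} {K : ℕ}
    (h₁ : BudgetRealizes R P₀ D₁ P₁) (hα : α = .onePlus ∨ α = .two)
    (h₂ : Realizes (relPow R K) P₁ (.unary i α i) P₁)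
    (h₃ : BudgetRealizes R P₁ (.unary i β j) P₃) :
    BudgetRealizes R P₀ (.unary k .three j) P₃ := by
  obtain ⟨K₁, q₁, h₁⟩ := h₁
  obtain ⟨K₂, q₂, h₂⟩ := h₂
  obtain ⟨K₃, q₃, h₃⟩ := h₃
  -- The threshold makes `B / 3` exceed every `Kᵢ` and allows at least one pass through the cycle.
  -- The two summands of the factor serve the cases `β ≠ .three` and `β = .three`.
  refine ⟨3 * (K + 1) * (K₁ + K₂ + K₃ + 1), 9 * (3 * (K + 1)) + 36 * q₃, fun B hB N hN x hx => ?_⟩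
  have hB3 : (K + 1) * (K₁ + K₂ + K₃ + 1) ≤ B / 3 := by
    rw [Nat.le_div_iff_mul_le (by norm_num)]
    nlinarith
  have hBK : K₁ + K₂ + K₃ + 1 ≤ B / 3 := le_trans (Nat.le_mul_of_pos_left _ (by omega)) hB3
  have hB3N : B / 3 ≤ N := (Nat.div_le_self _ _).trans hN
  obtain ⟨u, ⟨k₁, hk₁, hu⟩, huP, -⟩ := h₁ (B / 3) (by omega) N hB3N x hx
  have step : ∀ x, Large P₁ N x → ∃ y, relPow R K x y ∧ Large P₁ N y ∧ x i + N ≤ y i := by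
    intro x hx
    obtain ⟨y, hy, hyP, hyD⟩ := h₂ N (by omega) x hx
    refine ⟨y, hy, hyP, ?_⟩
    rcases hα with rfl | rfl <;> exact hyD.2
  -- Dividing by `K + 1` also covers `K = 0`.
  set t := B / 3 / (K + 1) with ht
  obtain ⟨v, hv, hvP, hvN⟩ := iterate_gain step t huP
  obtain ⟨y, ⟨k₃, hk₃, hy⟩, hyP, hyD⟩ := h₃ (B / 3) (by omega) N hB3N v hvP
  refine ⟨y, ⟨k₁ + t * K + k₃, ?_, relPow_add (relPow_add hu hv) hy⟩, hyP, ?_⟩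
  · have : t * (K + 1) ≤ B / 3 := Nat.div_mul_le_self _ _
    have : t * K ≤ t * (K + 1) := Nat.mul_le_mul_left _ (by omega)
    omega
  · simp only [Dep.Realized]
    have hB6 : B ≤ 6 * (B / 3) := by omega
    by_cases hβ : β = .three
    · subst hβ
      simp only [Dep.Realized] at hyD
      have := Nat.mul_le_mul hB6 hB6
      nlinarith
    · have hvy := hyD.le hβ
      have ht1 : 1 ≤ t := by
        rw [ht, Nat.le_div_iff_mul_le (by omega)]
        nlinarith
      have hlt : B / 3 < (K + 1) * (t + 1) := Nat.lt_mul_div_succ _ (by omega)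
      have hBt : B ≤ 12 * ((K + 1) * t) := by nlinarith
      have h4 : t * B ≤ y j := ((Nat.mul_le_mul_left _ hN).trans hvN).trans hvy
      have h5 : B * B ≤ 12 * ((K + 1) * t) * B := Nat.mul_le_mul_right _ hBt
      have h6 : 12 * (K + 1) * (t * B) ≤ 12 * (K + 1) * y j := Nat.mul_le_mul_left _ h4
      nlinarith

/-- Without correction a number of iterations independent of the store suffices; with correction the
type is 3. Hence the cycle in a correction, being of type 1⁺ or 2, always has fixed cost and can be
repeated. -/
theorem Derives.realizes_loop {l : Fin n} {C : Cmd n}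
    (ih : ∀ {P Q : Context n} {D : Dep n}, Derives C P D Q → Realizes (C.Sem .exact) P D Q)
    {P Q : Context n} {D : Dep n} (h : Derives (.loop l C) P D Q) :
    (∃ k, (l ∈ P → k = 0) ∧ Realizes (relPow (C.Sem .exact) k) P D Q) ∨
      (l ∉ P ∧ BudgetRealizes (C.Sem .exact) P D Q ∧ ∃ i j, D = .unary i .three j) := by
  generalize hL : Cmd.loop l C = L at h
  induction h with
  | unary h => subst hL; cases h
  | binary _ _ _ _ _ h => subst hL; cases h
  | choose_left => cases hL
  | choose_right => cases hL
  | seq => cases hL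
  | loop_zero h =>
    cases hL
    exact Or.inl ⟨0, fun _ => rfl, (h.realizes_atom (Or.inl rfl)).mono fun x y hxy => hxy.1⟩
  | loop_iterate m P D hl h hE =>
    cases hL
    exact Or.inl ⟨m + 1, fun h => absurd h hl, Realizes.prod (fun k hk => ih (h k hk)) hE⟩
  | @loop_correct _ _ _ _ _ D₁' _ _ _ _ _ hl h₁ h₂ h₃ hLC hF hE ih₁ ih₂ ih₃ =>
    cases hL
    right
    obtain ⟨i, δ, rfl, hδ, rfl⟩ := Dep.eq_of_loopCorrection hLC
    obtain ⟨k, rfl⟩ := Dep.comp_unary_three_right hF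
    obtain ⟨β, j, rfl, rfl⟩ := Dep.comp_unary_three_left hE
    refine ⟨hl, ?_, _, _, rfl⟩
    have b₁ := ih₁ rfl
    have b₃ := ih₃ rfl
    rcases ih₂ rfl with ⟨K, -, b₂⟩ | ⟨-, -, i', j', h⟩
    · refine BudgetRealizes.correct (D₁ := D₁') (β := β) (K := K) ?_ hδ b₂ ?_
      · rcases b₁ with ⟨_, -, b⟩ | ⟨-, b, -⟩
        · exact b.budget
        · exact b
      · rcases b₃ with ⟨_, -, b⟩ | ⟨-, b, -⟩
        · exact b.budget
        · exact b
    · exfalso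
      cases h
      rcases hδ with h | h <;> cases h

theorem Derives.realizes {C : Cmd n} {P Q : Context n} {D : Dep n} (h : Derives C P D Q) :
    Realizes (C.Sem .exact) P D Q := by
  induction C generalizing P Q D with
  | skip => exact (h.realizes_atom (Or.inl rfl)).mono fun x y hxy => hxy.1
  | assign l e => exact (h.realizes_atom (Or.inr ⟨l, e, rfl⟩)).mono fun x y hxy => hxy.1
  | seq C₁ C₂ ih₁ ih₂ =>
    cases h with
    | unary h => cases h
    | binary _ _ _ _ _ h => cases h
    | seq h₁ h₂ hD => exact (ih₁ h₁).comp (ih₂ h₂) hD fun x z y a b => ⟨z, a, b⟩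
  | choose C₁ C₂ ih₁ ih₂ =>
    cases h with
    | unary h => cases h
    | binary _ _ _ _ _ h => cases h
    | choose_left h => exact (ih₁ h).mono fun x y => Or.inl
    | choose_right h => exact (ih₂ h).mono fun x y => Or.inr
  | loop l C ih =>
    rcases h.realizes_loop ih with ⟨k, hk, K, q, h⟩ | ⟨hl, ⟨K, q, h⟩, -⟩
    · refine ⟨max K k, q, fun N hN x hx => ?_⟩
      obtain ⟨y, hy, hy'⟩ := h N ((le_max_left _ _).trans hN) x hx
      refine ⟨y, ⟨k, ?_, hy⟩, hy'⟩
      by_cases hl : l ∈ P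
      · simp [hk hl]
      · exact ((le_max_right _ _).trans hN).trans ((hx l).2 hl)
    · refine ⟨K, q, fun N hN x hx => ?_⟩
      -- The loop variable holds at least `N`, so the whole scale is available as budget.
      obtain ⟨y, ⟨k, hk, hy⟩, hy'⟩ := h N hN N le_rfl x hx
      exact ⟨y, ⟨k, hk.trans ((hx l).2 hl), hy⟩, hy'⟩

/-- Read off from the semantics: in a realizing run at a positive scale both endpoints are nonzero.
-/
theorem Derives.notMem {C : Cmd n} {P Q : Context n} {i j : Fin n} {δ : DepType}
    (h : Derives C P (.unary i δ j) Q) (hδ : δ = .one ∨ δ = .onePlus) : i ∉ P ∧ j ∉ Q := by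
  classical
  obtain ⟨K, q, h⟩ := h.realizes
  obtain ⟨y, -, hy, hD⟩ := h (K + 1) (by omega) (fun k => if k ∈ P then 0 else K + 1)
    fun k => ⟨fun hk => by simp [hk], fun hk => by simp [hk]⟩
  have hle := hD.le (by rcases hδ with rfl | rfl <;> simp)
  have hi : K + 1 ≤ if i ∈ P then 0 else K + 1 := by
    rcases hδ with rfl | rfl <;> exact hD.1
  refine ⟨fun hP => by simp [hP] at hi, fun hQ => ?_⟩
  have := (hy j).1 hQ
  omega

theorem Derives.not_linearlyBounded {m : AssignMode} {C : Cmd n} {i j : Fin n} {Q : Context n}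
    (h : Derives C ∅ (.unary i .three j) Q) : ¬ LinearlyBounded m C j := by
  rintro ⟨a, b, hab⟩
  obtain ⟨K, q, h⟩ := h.realizes
  set s := ∑ i, a i with hs
  -- With all inputs equal to `N`, a linear bound gives `N * N ≤ q * (s + b) * N`, impossible for `N
  -- > q * (s + b)`.
  set N := K + q * (s + b) + 1 with hN
  obtain ⟨y, hy, -, hyN⟩ := h N (by omega) (fun _ => N) fun k => ⟨by simp, fun _ => le_rfl⟩
  have hle := hab _ _ (Cmd.Sem.of_exact hy)
  rw [← Finset.sum_mul, ← hs] at hle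
  simp only [Dep.Realized] at hyN
  have h1 : y j ≤ (s + b) * N := by nlinarith
  have h2 : q * y j ≤ q * ((s + b) * N) := Nat.mul_le_mul_left _ h1
  have h3 : (q * (s + b) + 1) * N ≤ N * N := Nat.mul_le_mul_right _ (by omega)
  nlinarith

/-! ## Upper bounds: runs are controlled by derivable unary dependences -/

/-- The variables holding zero. -/
def zeros (x : Store n) : Context n := {k | x k = 0}

open Classical in
/-- The value `y j` is either exempt, being the target of a dependence of type `3`, or bounded by
the source of a dependence of type `1`, or by `A` times the sum of the sources of the dependences
of type `1⁺`. -/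
def Controlled (E : Fin n → DepType → Fin n → Prop) (A : ℕ) (x y : Store n) (j : Fin n) : Prop :=
  (∃ i, x i ≠ 0 ∧ E i .three j) ∨ (∃ i, E i .one j ∧ y j ≤ x i) ∨
    y j ≤ A * ∑ i with E i .onePlus j, x i

theorem Controlled.of_eq_zero {E : Fin n → DepType → Fin n → Prop} {A : ℕ} {x y : Store n}
    {j : Fin n} (h : y j = 0) : Controlled E A x y j :=
  Or.inr (Or.inr (by simp [h]))

theorem Controlled.mono {E E' : Fin n → DepType → Fin n → Prop} {A A' : ℕ} {x y : Store n}
    {j : Fin n} (h : Controlled E A x y j) (hE : ∀ i δ, E i δ j → E' i δ j) (hA : A ≤ A') :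
    Controlled E' A' x y j := by
  classical
  refine h.imp (fun ⟨i, hi, h⟩ => ⟨i, hi, hE _ _ h⟩)
    (Or.imp (fun ⟨i, h, hi⟩ => ⟨i, hE _ _ h, hi⟩) fun h => h.trans (Nat.mul_le_mul hA ?_))
  exact Finset.sum_le_sum_of_subset (Finset.monotone_filter_right _ fun i _ => hE i _)

theorem Controlled.exists_source {E : Fin n → DepType → Fin n → Prop} {A : ℕ} {x y : Store n}
    {j : Fin n} (h : Controlled E A x y j) (hj : y j ≠ 0) : ∃ i δ, x i ≠ 0 ∧ E i δ j := by
  classical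
  rcases h with ⟨i, hi, h⟩ | ⟨i, h, hi⟩ | h
  · exact ⟨i, _, hi, h⟩
  · exact ⟨i, _, by omega, h⟩
  · have : ∑ i with E i .onePlus j, x i ≠ 0 := by
      intro h0
      rw [h0] at h
      omega
    obtain ⟨i, hi, hne⟩ := Finset.exists_ne_zero_of_sum_ne_zero this
    exact ⟨i, _, hne, (Finset.mem_filter.1 hi).2⟩

/-- The coefficient is allowed to depend on the intermediate variable: a link of type 1 then merely
passes on the coefficient of its source, which is what makes the loop argument work. In `hplus`, `n`
counts the summands and the `+ 1` covers an intermediate value bounded by a single source. -/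
theorem Controlled.comp {E₁ E₂ E : Fin n → DepType → Fin n → Prop} {A₁ : Fin n → ℕ} {A₂ A : ℕ}
    {x z y : Store n} {j : Fin n}
    (hE : ∀ i u α β, E₁ i α u → E₂ u β j → E i (α.sup β) j)
    (h₁ : ∀ u, Controlled E₁ (A₁ u) x z u) (h₂ : Controlled E₂ A₂ z y j)
    (hone : ∀ u, E₂ u .one j → A₁ u ≤ A)
    (hplus : ∀ u, E₂ u .onePlus j → n * A₂ * (A₁ u + 1) ≤ A) : Controlled E A x y j := by
  classical
  by_cases h3 : ∃ i, x i ≠ 0 ∧ E i .three j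
  · exact Or.inl h3
  have hsum : ∀ u β, β ≠ .three → β ≠ .two → E₂ u β j →
      ∑ i with E₁ i .onePlus u, x i ≤ ∑ i with E i .onePlus j, x i := by
    intro u β hβ hβ' hu
    refine Finset.sum_le_sum_of_subset (Finset.monotone_filter_right _ fun i _ hi => ?_)
    have := hE _ _ _ _ hi hu
    cases β <;> first | exact this | exact absurd rfl hβ | exact absurd rfl hβ'
  have hno3 : ∀ u β, E₂ u β j → ¬ ∃ i, x i ≠ 0 ∧ E₁ i .three u := by
    rintro u β hu ⟨i, hi, h⟩
    refine h3 ⟨i, hi, ?_⟩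
    have := hE _ _ _ _ h hu
    cases β <;> exact this
  rcases h₂ with ⟨u, hu, h⟩ | ⟨u, h, hu⟩ | h
  · obtain ⟨i, δ, hi, hiu⟩ := (h₁ u).exists_source hu
    have := hE _ _ _ _ hiu h
    refine Or.inl ⟨i, hi, ?_⟩
    cases δ <;> exact this
  · rcases h₁ u with h' | ⟨i, h', hi⟩ | h'
    · exact absurd h' (hno3 _ _ h)
    · exact Or.inr (Or.inl ⟨i, hE _ _ _ _ h' h, hu.trans hi⟩)
    · exact Or.inr (Or.inr (hu.trans (h'.trans
        (Nat.mul_le_mul (hone u h) (hsum u _ (by simp) (by simp) h)))))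
  · refine Or.inr (Or.inr (h.trans ?_))
    set S := ∑ i with E i .onePlus j, x i with hS
    have hterm : ∀ u ∈ Finset.univ.filter (fun u => E₂ u .onePlus j), n * (A₂ * z u) ≤ A * S := by
      intro u hu
      have hu := (Finset.mem_filter.1 hu).2
      have hz : z u ≤ (A₁ u + 1) * S := by
        rcases h₁ u with h' | ⟨i, h', hi⟩ | h'
        · exact absurd h' (hno3 _ _ hu)
        · have hmem : i ∈ Finset.univ.filter (fun i => E i .onePlus j) :=
            Finset.mem_filter.2 ⟨Finset.mem_univ _, hE _ _ _ _ h' hu⟩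
          have : x i ≤ S := Finset.single_le_sum (f := x) (fun _ _ => Nat.zero_le _) hmem
          nlinarith
        · have := hsum u _ (by simp) (by simp) hu
          have := Nat.mul_le_mul_left (A₁ u) this
          nlinarith
      calc n * (A₂ * z u) ≤ n * (A₂ * ((A₁ u + 1) * S)) := by gcongr
        _ = n * A₂ * (A₁ u + 1) * S := by ring
        _ ≤ A * S := Nat.mul_le_mul_right _ (hplus u hu)
    -- After multiplication by `n`, each of the at most `n` summands is bounded by `A * S`.
    have hn : 0 < n := j.pos
    refine Nat.le_of_mul_le_mul_left ?_ hn
    rw [Finset.mul_sum, Finset.mul_sum]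
    refine (Finset.sum_le_card_nsmul _ _ _ hterm).trans ?_
    rw [smul_eq_mul]
    refine Nat.mul_le_mul_right _ ((Finset.card_le_univ _).trans (by simp))

/-! ### Upper bounds for assignments -/

theorem zeros_update {x : Store n} {l : Fin n} {v : ℕ} {c : Prop} (h : v = 0 ↔ c) :
    zeros (Function.update x l v) = (zeros x \ {l}) ∪ {k | k = l ∧ c} := by
  ext k
  by_cases hk : k = l
  · subst hk
    simpa [zeros] using h
  · simp [zeros, hk]

theorem zeros_update_zero (x : Store n) (l : Fin n) :
    zeros (Function.update x l 0) = zeros x ∪ {l} := by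
  ext k
  by_cases hk : k = l
  · subst hk
    simp [zeros]
  · simp [zeros, hk]

theorem zeros_update_var (x : Store n) (l r : Fin n) :
    zeros (Function.update x l (x r)) = (zeros x \ {l}) ∪ {k | k = l ∧ r ∈ zeros x} :=
  zeros_update Iff.rfl

theorem zeros_update_mul (x : Store n) (l r s : Fin n) :
    zeros (Function.update x l (x r * x s)) =
      (zeros x \ {l}) ∪ {k | k = l ∧ (r ∈ zeros x ∨ s ∈ zeros x)} :=
  zeros_update (by simp [zeros])

theorem zeros_update_add (x : Store n) (l r s : Fin n) :
    zeros (Function.update x l (x r + x s)) =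
      (zeros x \ {l}) ∪ {k | k = l ∧ (r ∈ zeros x ∧ s ∈ zeros x)} :=
  zeros_update (by simp [zeros])

theorem derives_assign_keep {l i : Fin n} {e : Expr n} (he : e.WellFormed) {x : Store n}
    (hi : x i ≠ 0) (hil : i ≠ l) :
    Derives (.assign l e) (zeros x) (.unary i .one i)
      (zeros (Function.update x l (e.eval x))) := by
  refine Derives.unary ?_
  cases e with
  | var r => exact zeros_update_var x l r ▸ AtomUnary.var_keep _ _ _ _ hi hil
  | add r s => exact zeros_update_add x l r s ▸ AtomUnary.add_keep _ _ _ _ _ he hi hil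
  | mul r s => exact zeros_update_mul x l r s ▸ AtomUnary.mul_keep _ _ _ _ _ hi hil
  | zero => exact zeros_update_zero x l ▸ AtomUnary.zero _ _ _ hi hil

theorem controlled_assign {l : Fin n} {e : Expr n} (he : e.WellFormed) (x : Store n) (j : Fin n) :
    Controlled (fun i δ j => Derives (.assign l e) (zeros x) (.unary i δ j)
      (zeros (Function.update x l (e.eval x)))) 1 x (Function.update x l (e.eval x)) j := by
  classical
  by_cases hj : Function.update x l (e.eval x) j = 0
  · exact Controlled.of_eq_zero hj
  by_cases hjl : j = l
  · subst hjl
    rw [Function.update_self] at hj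
    cases e with
    | var r =>
      refine Or.inr (Or.inl ⟨r, Derives.unary ?_, by simp [Expr.eval]⟩)
      exact zeros_update_var x j r ▸ AtomUnary.var_copy _ _ _ hj
    | add r s =>
      have hz := zeros_update_add x j r s
      simp only [Expr.eval] at hj
      by_cases hr : x r = 0
      · have hs : x s ≠ 0 := by omega
        refine Or.inr (Or.inl ⟨s, Derives.unary ?_, by simp [Expr.eval, hr]⟩)
        exact hz ▸ AtomUnary.add_right _ _ _ _ he hr hs
      by_cases hs : x s = 0
      · refine Or.inr (Or.inl ⟨r, Derives.unary ?_, by simp [Expr.eval, hs]⟩)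
        exact hz ▸ AtomUnary.add_left _ _ _ _ he hr hs
      · refine Or.inr (Or.inr ?_)
        have hrs : r ≠ s := he
        have key : ∀ t, t = r ∨ t = s → Derives (.assign j (.add r s)) (zeros x)
            (.unary t .onePlus j) (zeros (Function.update x j ((Expr.add r s).eval x))) :=
          fun t ht => Derives.unary (hz ▸ AtomUnary.add_both _ _ _ _ _ he hr hs ht)
        have hsum : Function.update x j ((Expr.add r s).eval x) j = ∑ t ∈ {r, s}, x t := by
          rw [Finset.sum_pair hrs, Function.update_self, Expr.eval]
        rw [one_mul, hsum]
        exact Finset.sum_le_sum_of_subset fun t ht =>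
          Finset.mem_filter.2 ⟨Finset.mem_univ _, key t (by simpa using ht)⟩
    | mul r s =>
      have hrs : x r ≠ 0 ∧ x s ≠ 0 := by simpa [Expr.eval] using hj
      refine Or.inl ⟨r, hrs.1, Derives.unary ?_⟩
      exact zeros_update_mul x j r s ▸ AtomUnary.mul _ _ _ _ _ hrs.1 hrs.2 (Or.inl rfl)
    | zero => exact absurd rfl hj
  · rw [Function.update_of_ne hjl] at hj
    exact Or.inr (Or.inl ⟨j, derives_assign_keep he hj hjl, by simp [Function.update_of_ne hjl]⟩)

/-- Compositions of zero or more unary dependences of `C`. -/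
inductive Chain (C : Cmd n) (P : Context n) (i : Fin n) :
    DepType → Fin n → Context n → Prop
  | refl (hi : i ∉ P) : Chain C P i .one i P
  | snoc {Q R : Context n} {u v : Fin n} {α β : DepType} (h : Chain C P i α u Q)
      (h' : Derives C Q (.unary u β v) R) : Chain C P i (α.sup β) v R

/-! ### Chains of dependences and upper bounds for loops -/

theorem DepType.sup_assoc (α β γ : DepType) : (α.sup β).sup γ = α.sup (β.sup γ) := by
  cases α <;> cases β <;> cases γ <;> rfl

theorem DepType.sup_one (α : DepType) : α.sup .one = α := by
  cases α <;> rfl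

theorem DepType.one_sup (α : DepType) : DepType.sup .one α = α := by
  cases α <;> rfl

theorem DepType.three_sup (α : DepType) : DepType.sup .three α = .three := by
  cases α <;> rfl

theorem Chain.trans {C : Cmd n} {P Q R : Context n} {i u v : Fin n} {α β : DepType}
    (h : Chain C P i α u Q) (h' : Chain C Q u β v R) : Chain C P i (α.sup β) v R := by
  induction h' with
  | refl => rwa [DepType.sup_one]
  | snoc _ h' ih =>
    rw [← DepType.sup_assoc]
    exact ih.snoc h'

theorem Dep.prod_congr {D D' : ℕ → Dep n} {m : ℕ} (h : ∀ k ≤ m, D k = D' k) :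
    Dep.prod D m = Dep.prod D' m := by
  induction m with
  | zero => simp [Dep.prod, h 0 le_rfl]
  | succ m ih => rw [Dep.prod, Dep.prod, ih fun k hk => h k (by omega), h (m + 1) le_rfl]

theorem Dep.comp_unary (i u v : Fin n) (α β : DepType) :
    (Dep.unary i α u).comp (.unary u β v) = some (.unary i (α.sup β) v) := by
  simp [Dep.comp]

theorem Chain.derives_loop {l : Fin n} {C : Cmd n} {P Q : Context n} {i v : Fin n} {δ : DepType}
    (h : Chain C P i δ v Q) (hl : l ∉ P) : Derives (.loop l C) P (.unary i δ v) Q := by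
  -- The empty chain needs the rule for zero iterations, since iterating requires at least one.
  -- Otherwise `m + 1` links pass through `m + 2` contexts.
  have key : (i ∉ P ∧ δ = .one ∧ i = v ∧ P = Q) ∨
      ∃ (m : ℕ) (Pf : ℕ → Context n) (D : ℕ → Dep n), Pf 0 = P ∧ Pf (m + 1) = Q ∧
        (∀ k, k ≤ m → Derives C (Pf k) (D k) (Pf (k + 1))) ∧
        Dep.prod D m = some (.unary i δ v) := by
    induction h with
    | refl hi => exact Or.inl ⟨hi, rfl, rfl, rfl⟩
    | @snoc Q R u v α β _ h' ih =>
      right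
      rcases ih with ⟨-, rfl, rfl, rfl⟩ | ⟨m, Pf, D, h0, hm, hD, hE⟩
      · refine ⟨0, fun k => if k = 0 then P else R, fun _ => .unary i β v, rfl, rfl, ?_, ?_⟩
        · intro k hk
          obtain rfl : k = 0 := by omega
          simpa using h'
        · rw [DepType.one_sup]
          rfl
      · refine ⟨m + 1, fun k => if k ≤ m + 1 then Pf k else R,
          fun k => if k ≤ m then D k else .unary u β v, by simpa using h0, by simp, ?_, ?_⟩
        · intro k hk
          by_cases hkm : k ≤ m
          · have h1 : k ≤ m + 1 := by omega
            simpa [hkm, h1] using hD k hkm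
          · obtain rfl : k = m + 1 := by omega
            simpa [hm] using h'
        · have e : Dep.prod (fun k => if k ≤ m then D k else .unary u β v) m = Dep.prod D m :=
            Dep.prod_congr fun k hk => by simp [hk]
          rw [Dep.prod, e, hE]
          simpa using Dep.comp_unary i u v α β
  rcases key with ⟨hi, rfl, rfl, rfl⟩ | ⟨m, Pf, D, rfl, rfl, hD, hE⟩
  · exact Derives.loop_zero (Derives.unary (AtomUnary.skip _ _ hi))
  · exact Derives.loop_iterate m Pf D hl hD hE

/-- A variable that is not assigned keeps its value, and this is derivable. -/
theorem Cmd.Sem.derives_keep {C : Cmd n} (hC : C.WellFormed) {x y : Store n}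
    (h : C.Sem .exact x y) {i : Fin n} (hi : x i ≠ 0) (hiC : ¬ C.Assigns i) :
    Derives C (zeros x) (.unary i .one i) (zeros y) ∧ y i = x i := by
  induction C generalizing x y with
  | skip => cases h; exact ⟨Derives.unary (AtomUnary.skip _ _ hi), rfl⟩
  | assign l e =>
    obtain ⟨v, hv, rfl⟩ := h
    cases hv
    exact ⟨derives_assign_keep hC hi hiC, Function.update_of_ne hiC _ _⟩
  | seq C₁ C₂ ih₁ ih₂ =>
    obtain ⟨z, h₁, h₂⟩ := h
    obtain ⟨d₁, e₁⟩ := ih₁ hC.1 h₁ hi fun h => hiC (Or.inl h)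
    obtain ⟨d₂, e₂⟩ := ih₂ hC.2 h₂ (e₁ ▸ hi) fun h => hiC (Or.inr h)
    exact ⟨d₁.seq d₂ (Dep.comp_unary _ _ _ _ _), e₂.trans e₁⟩
  | choose C₁ C₂ ih₁ ih₂ =>
    rcases h with h | h
    · obtain ⟨d, e⟩ := ih₁ hC.1 h hi fun h => hiC (Or.inl h)
      exact ⟨d.choose_left, e⟩
    · obtain ⟨d, e⟩ := ih₂ hC.2 h hi fun h => hiC (Or.inr h)
      exact ⟨d.choose_right, e⟩
  | loop l C ih =>
    obtain ⟨k, hk, h⟩ := h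
    have key : ∀ k y, relPow (C.Sem .exact) k x y →
        Chain C (zeros x) i .one i (zeros y) ∧ y i = x i := by
      intro k
      induction k with
      | zero => rintro y rfl; exact ⟨Chain.refl hi, rfl⟩
      | succ k ihk =>
        rintro y ⟨z, hz, hy⟩
        obtain ⟨c, e⟩ := ihk z hz
        obtain ⟨d, e'⟩ := ih hC.2 hy (e ▸ hi) hiC
        exact ⟨c.snoc d, e'.trans e⟩
    obtain ⟨c, e⟩ := key k y h
    refine ⟨?_, e⟩
    by_cases hl : x l = 0
    · obtain rfl : k = 0 := by omega
      cases h
      exact Derives.loop_zero (Derives.unary (AtomUnary.skip _ _ hi))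
    · exact c.derives_loop hl

/-- Dependences of `loop l C`: chains of dependences of `C`, and those obtained by correcting a
chain of type `1⁺` from a variable to itself. -/
def LoopReach (l : Fin n) (C : Cmd n) (P Q : Context n) (i : Fin n) (δ : DepType) (v : Fin n) :
    Prop :=
  Chain C P i δ v Q ∨ (i = l ∧ δ = .three ∧ ∃ P₁ u β,
    Chain C P l .one l P₁ ∧ Chain C P₁ u .onePlus u P₁ ∧ Chain C P₁ u β v Q)

/-- Correcting the cycle at `u` gives a type 3 dependence of `u` on `l`, which is joined to the
start by the type 1 chain from `l` to itself. That chain also shows that `l` is nonzero in `P₁`. -/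
theorem LoopReach.derives {l : Fin n} {C : Cmd n} {P Q : Context n} {i v : Fin n} {δ : DepType}
    (h : LoopReach l C P Q i δ v) (hl : l ∉ P) :
    Derives (.loop l C) P (.unary i δ v) Q := by
  rcases h with h | ⟨rfl, rfl, P₁, u, β, h₁, h₂, h₃⟩
  · exact h.derives_loop hl
  · have hl₁ := ((h₁.derives_loop hl).notMem (Or.inl rfl)).2
    refine Derives.loop_correct (L := .unary i .three u) (F := .unary i .three u) hl
      (h₁.derives_loop hl) (h₂.derives_loop hl₁) (h₃.derives_loop hl₁) ?_ ?_ ?_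
    · simp [Dep.loopCorrection]
    · exact Dep.comp_unary _ _ _ _ _
    · rw [Dep.comp_unary, DepType.three_sup]

/-- The number of pairs of a context and a variable, reachable from `P`, from which a chain of
type `1⁺` leads to the variable `v` in the context `Q`. -/
noncomputable def chainRank (l : Fin n) (C : Cmd n) (P Q : Context n) (v : Fin n) : ℕ :=
  {p : Context n × Fin n | Chain C P l .one l p.1 ∧ Chain C p.1 p.2 .onePlus v Q}.ncard

theorem chainRank_le (l : Fin n) (C : Cmd n) (P Q : Context n) (v : Fin n) :
    chainRank l C P Q v ≤ Nat.card (Context n × Fin n) := by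
  rw [chainRank, ← Set.ncard_univ]
  exact Set.ncard_le_ncard (Set.subset_univ _) (Set.toFinite _)

theorem chainRank_le_of_one {l : Fin n} {C : Cmd n} {P Q R : Context n} {u v : Fin n}
    (h : Derives C Q (.unary u .one v) R) : chainRank l C P Q u ≤ chainRank l C P R v :=
  Set.ncard_le_ncard (fun _ hp => ⟨hp.1, hp.2.snoc h⟩) (Set.toFinite _)

/-- The pair `(Q, u)` is counted at `v` because of the link itself, but not at `u`, as there is no
1⁺ cycle. -/
theorem chainRank_lt_of_onePlus {l : Fin n} {C : Cmd n} {P Q R : Context n} {u v : Fin n}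
    (h : Derives C Q (.unary u .onePlus v) R) (hu : u ∉ Q) (hQ : Chain C P l .one l Q)
    (hQu : ¬ Chain C Q u .onePlus u Q) : chainRank l C P Q u < chainRank l C P R v := by
  refine Set.ncard_lt_ncard ⟨fun _ hp => ⟨hp.1, hp.2.snoc h⟩, fun hsub => ?_⟩ (Set.toFinite _)
  exact hQu (hsub (a := (Q, u)) ⟨hQ, (Chain.refl hu).snoc h⟩).2

/-- The exponent is a rank instead of the iteration count: it is unaffected by the length of the run
and grows only along 1⁺ links outside cycles. -/
theorem controlled_iterate {l : Fin n} {C : Cmd n} (hlC : ¬ C.Assigns l) (hC : C.WellFormed)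
    {A : ℕ} (ih : ∀ x y, C.Sem .exact x y → ∀ j,
      Controlled (fun i δ j => Derives C (zeros x) (.unary i δ j) (zeros y)) A x y j)
    {x : Store n} (hl : x l ≠ 0) {k : ℕ} {y : Store n} (h : relPow (C.Sem .exact) k x y) :
    y l ≠ 0 ∧ Chain C (zeros x) l .one l (zeros y) ∧ ∀ j,
      Controlled (LoopReach l C (zeros x) (zeros y))
        ((2 * n * A + 1) ^ chainRank l C (zeros x) (zeros y) j) x y j := by
  induction k generalizing y with
  | zero =>
    cases h
    refine ⟨hl, Chain.refl hl, fun j => ?_⟩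
    by_cases hj : x j = 0
    · exact Controlled.of_eq_zero hj
    · exact Or.inr (Or.inl ⟨j, Or.inl (Chain.refl hj), le_rfl⟩)
  | succ k ihk =>
    obtain ⟨z, hz, hy⟩ := h
    obtain ⟨hzl, hzc, hzj⟩ := ihk hz
    obtain ⟨hd, hyl⟩ := hy.derives_keep hC hzl hlC
    refine ⟨hyl ▸ hzl, hzc.snoc hd, fun j => ?_⟩
    by_cases h3 : ∃ i, x i ≠ 0 ∧ LoopReach l C (zeros x) (zeros y) i .three j
    · exact Or.inl h3
    set B := 2 * n * A + 1 with hB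
    refine Controlled.comp ?_ hzj (ih z y hy j) (fun u hu => ?_) (fun u hu => ?_)
    · rintro i u α β (h | ⟨rfl, rfl, P₁, w, γ, h₁, h₂, h₃⟩) h'
      · exact Or.inl (h.snoc h')
      · exact Or.inr ⟨rfl, DepType.three_sup β, P₁, w, _, h₁, h₂, h₃.snoc h'⟩
    · exact Nat.pow_le_pow_right (by omega) (chainRank_le_of_one hu)
    · have hzu := (hu.notMem (Or.inr rfl)).1
      -- A 1⁺ cycle at `u` would, after correction, give the type 3 dependence of `j` on `l`
      -- excluded by `h3`.
      have hlt := chainRank_lt_of_onePlus hu hzu hzc fun hc =>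
        h3 ⟨l, hl, Or.inr ⟨rfl, rfl, _, u, _, hzc, hc, (Chain.refl hzu).snoc hu⟩⟩
      set r := chainRank l C (zeros x) (zeros z) u
      have h1 : 1 ≤ B ^ r := Nat.one_le_pow _ _ (by omega)
      calc n * A * (B ^ r + 1) ≤ n * A * (2 * B ^ r) := by gcongr; omega
        _ ≤ B * B ^ r := by rw [hB]; ring_nf; omega
        _ = B ^ (r + 1) := by ring
        _ ≤ _ := Nat.pow_le_pow_right (by omega) hlt

theorem exists_controlled {C : Cmd n} (hC : C.WellFormed) :
    ∃ A, ∀ x y, C.Sem .exact x y → ∀ j,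
      Controlled (fun i δ j => Derives C (zeros x) (.unary i δ j) (zeros y)) A x y j := by
  induction C with
  | skip =>
    refine ⟨0, ?_⟩
    rintro x y rfl j
    by_cases hj : x j = 0
    · exact Controlled.of_eq_zero hj
    · exact Or.inr (Or.inl ⟨j, Derives.unary (AtomUnary.skip _ _ hj), le_rfl⟩)
  | assign l e =>
    refine ⟨1, ?_⟩
    rintro x y ⟨v, rfl, rfl⟩ j
    exact controlled_assign hC x j
  | seq C₁ C₂ ih₁ ih₂ =>
    obtain ⟨A₁, h₁⟩ := ih₁ hC.1
    obtain ⟨A₂, h₂⟩ := ih₂ hC.2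
    refine ⟨n * A₂ * (A₁ + 1) + A₁, ?_⟩
    rintro x y ⟨z, hz, hy⟩ j
    exact Controlled.comp (A₁ := fun _ => A₁)
      (fun i u α β h h' => Derives.seq h h' (Dep.comp_unary _ _ _ _ _)) (h₁ x z hz) (h₂ z y hy j)
      (fun _ _ => Nat.le_add_left _ _) (fun _ _ => Nat.le_add_right _ _)
  | choose C₁ C₂ ih₁ ih₂ =>
    obtain ⟨A₁, h₁⟩ := ih₁ hC.1
    obtain ⟨A₂, h₂⟩ := ih₂ hC.2
    refine ⟨max A₁ A₂, ?_⟩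
    rintro x y (h | h) j
    · exact (h₁ x y h j).mono (fun _ _ => Derives.choose_left) (le_max_left _ _)
    · exact (h₂ x y h j).mono (fun _ _ => Derives.choose_right) (le_max_right _ _)
  | loop l C ih =>
    obtain ⟨A, hA⟩ := ih hC.2
    refine ⟨(2 * n * A + 1) ^ Nat.card (Context n × Fin n), ?_⟩
    rintro x y ⟨k, hk, h⟩ j
    by_cases hl : x l = 0
    · obtain rfl : k = 0 := by omega
      cases h
      by_cases hj : x j = 0
      · exact Controlled.of_eq_zero hj
      · exact Or.inr (Or.inl
          ⟨j, Derives.loop_zero (Derives.unary (AtomUnary.skip _ _ hj)), le_rfl⟩)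
    · obtain ⟨-, -, hj⟩ := controlled_iterate hC.1 hC.2 hA hl h
      exact (hj j).mono (fun _ _ h => h.derives hl)
        (Nat.pow_le_pow_right (by omega) (chainRank_le _ _ _ _ _))

theorem linearlyBounded_of_not_derives {m : AssignMode} {C : Cmd n} (hC : C.WellFormed)
    {j : Fin n} (h : ¬ ∃ (i : Fin n) (Q : Context n), Derives C ∅ (.unary i .three j) Q) :
    LinearlyBounded m C j := by
  classical
  obtain ⟨A, hA⟩ := exists_controlled hC
  -- Raising every input by one makes the initial context empty; the constant `(A + 1) * n` pays for
  -- this. The coefficient `A + 1` is positive, as sources of type 1 require.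
  refine ⟨fun _ => A + 1, (A + 1) * n, fun x y hxy => ?_⟩
  obtain ⟨y', hy', hle⟩ := hxy.exists_exact_ge (x' := fun i => x i + 1) fun i => Nat.le_succ _
  have hz : zeros (fun i => x i + 1) = ∅ := by ext k; simp [zeros]
  have hsum : ∑ i, (A + 1) * x i + (A + 1) * n = (A + 1) * ∑ i, (x i + 1) := by
    rw [← Finset.mul_sum, Finset.sum_add_distrib, mul_add]
    simp
  rw [hsum]
  refine (hle j).trans ?_
  rcases hA _ _ hy' j with ⟨i, -, h'⟩ | ⟨i, -, hi⟩ | h'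
  · exact absurd ⟨i, _, hz ▸ h'⟩ h
  · have := Finset.single_le_sum (f := fun i => x i + 1) (fun _ _ => Nat.zero_le _)
      (Finset.mem_univ i)
    exact hi.trans (this.trans (Nat.le_mul_of_pos_left _ (Nat.succ_pos _)))
  · exact h'.trans (Nat.mul_le_mul (Nat.le_succ _)
      (Finset.sum_le_sum_of_subset (Finset.subset_univ _)))

end LoopLang

theorem theorem3 {n : ℕ} (m : LoopLang.AssignMode) (C : LoopLang.Cmd n) (hC : C.WellFormed)
    (j : Fin n) :
    ((∃ (i : Fin n) (Q : LoopLang.Context n),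
        LoopLang.Derives C ∅ (LoopLang.Dep.unary i LoopLang.DepType.three j) Q) →
      ¬ LoopLang.LinearlyBounded m C j) ∧
    ((¬ ∃ (i : Fin n) (Q : LoopLang.Context n),
        LoopLang.Derives C ∅ (LoopLang.Dep.unary i LoopLang.DepType.three j) Q) →
      LoopLang.LinearlyBounded m C j) :=
  ⟨fun ⟨_, _, h⟩ => h.not_linearlyBounded, LoopLang.linearlyBounded_of_not_derives hC⟩
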